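/- For $\rho\in\mathbb R$ and a nonnegative Borel measure $\mu$ on $[0,\infty)$ put $$\|\mu\|_\rho=\sup_{R>1}\frac{1}{(1+R)^\rho}\,\frac1R\,\mu([R/2,R])+\mu([0,1]),\qquad \mathcal M_+^\rho=\{\mu\ge 0:\ \|\mu\|_\rho<\infty\}.$$ Let $f_0$ be a nonnegative measure on $(0,\infty)$. A family $(g(t))_{t\ge 0}$ of nonnegative measures on $[0,\infty)$, formally $g(t,\omega)=\sqrt\omega f(t,\omega)$, is called a (mass and energy conserving, nonnegative) weak solution of the radial 4-wave kinetic equation $$\partial_t f_1=\iint \frac{\min_i\sqrt{\omega_i}}{\sqrt{\omega_1}}\big[(f_1+f_2)f_3f_4-(f_3+f_4)f_1f_2\big]\,d\omega_3\,d\omega_4,\qquad \omega_2=\omega_3+\omega_4-\omega_1\geq 0,$$ with initial data $f_0$ (in the class $\mathcal M_+^\rho$) if 1. $g\in C([0,\infty);\mathcal M_+^\rho)$, for the weak topology of measures (tested against continuous compactly supported functions on $[0,\infty)$); 2. for all $\varphi\in C^2_c([0,\infty)\times[0,\infty))$ and all $t_*>0$, $$\int g(t_*,d\omega)\,\varphi(t_*,\omega)-\int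 \varphi(0,\omega)\sqrt\omega\,f_0(d\omega)=\int_0^{t_*}\!\!\int g(t,d\omega)\,\partial_t\varphi(t,\omega)\,dt$$ $$+\int_0^{t_*}\!\!\iiint_{[0,\infty)^3}\frac{\Phi}{\sqrt{\omega_1\omega_2\omega_3}}\big[\varphi(t,\omega_1+\omega_2-\omega_3)+\varphi(t,\omega_3)-\varphi(t,\omega_1)-\varphi(t,\omega_2)\big]\,g(t,d\omega_1)\,g(t,d\omega_2)\,g(t,d\omega_3)\,dt,$$ where $\Phi=\min\{\sqrt{\omega_1},\sqrt{\omega_2},\sqrt{\omega_3},\sqrt{\omega_4}\}$, $\omega_4=(\omega_1+\omega_2-\omega_3)_+$, and the integrand is extended by continuity to the points where some of $\omega_1,\omega_2,\omega_3$ vanish; 3. for all $t>0$, $\int g(t,d\omega)=\int\sqrt\omega f_0(d\omega)$ and $\int \omega\, g(t,d\omega)=\int\omega\sqrt\omega f_0(d\omega)$ (in $[0,\infty]$). **Theorem.** There exists a numerical constant $C>0$ such that, for all $A>0$, $B>0$, $\rho<-1$ and all $g_0\in\mathcal M_+^\rho$, if $$f_0(\omega)=A\omega^{-1}\mathbf 1_{0<\omega<B}+\min\Big(A\omega^{-1},\frac{g_0(\omega)}{\sqrt\omega}\Big)\mathbf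 1_{\omega>B}$$ (the minimum being the infimum of the two measures $A\omega^{-1}d\omega$ and $\omega^{-1/2}g_0$, i.e. the minimum of the densities if $g_0$ has one), then every weak solution $g$ with initial data $f_0$ satisfies $$g(t,\{0\})>0\qquad\text{for all } t>CA^{-2}.$$ -/

import Mathlib

open MeasureTheory Set
open scoped ENNReal

noncomputable section

namespace WaveKinetic

/-- The quantity `‖μ‖_ρ = sup_{R > 1} (1 + R)^{-ρ} R⁻¹ μ([R/2, R]) + μ([0, 1])`, with values
in `[0, ∞]`. -/
def rhoNorm (ρ : ℝ) (μ : Measure ℝ) : ℝ≥0∞ :=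
  (⨆ R ∈ Ioi (1 : ℝ), ENNReal.ofReal (1 / (1 + R) ^ ρ * (1 / R)) * μ (Icc (R / 2) R))
    + μ (Icc 0 1)

/-- `μ ∈ 𝓜₊^ρ([0, ∞))`: a nonnegative measure carried by `[0, ∞)` with `‖μ‖_ρ < ∞`. -/
def MemMRho (ρ : ℝ) (μ : Measure ℝ) : Prop :=
  μ (Iio 0) = 0 ∧ rhoNorm ρ μ < ∞

/-- The measure `g = √ω f` attached to a measure `f` on `[0, ∞)`. -/
def sqrtMul (f : Measure ℝ) : Measure ℝ :=
  f.withDensity fun ω => ENNReal.ofReal (√ω)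

/-- The collision kernel `Φ / √(ω₁ ω₂ ω₃)`, where
`Φ = min {√ω₁, √ω₂, √ω₃, √ω₄}` and `ω₄ = (ω₁ + ω₂ - ω₃)₊` (`√` vanishes on negative numbers).
The quotient reads `0 / 0` where some `ωᵢ` vanishes; there it is given its limiting value:
`1 / √(ω₂ ω₃)` (if `ω₃ ≤ ω₂`, and `0` otherwise) on `ω₁ = 0`, symmetrically on `ω₂ = 0`, and
`1 / √(ω₁ ω₂)` on `ω₃ = 0`. With these values the product of the kernel with
`φ(ω₁ + ω₂ - ω₃) + φ(ω₃) - φ(ω₁) - φ(ω₂)`, `φ ∈ C²`, is continuous on `[0, ∞)³`; where two of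
the `ωᵢ` vanish the product is `0`, whatever the value of the kernel. -/
def kernel (ω₁ ω₂ ω₃ : ℝ) : ℝ :=
  if ω₁ = 0 then (if ω₃ ≤ ω₂ then 1 / √(ω₂ * ω₃) else 0)
  else if ω₂ = 0 then (if ω₃ ≤ ω₁ then 1 / √(ω₁ * ω₃) else 0)
  else if ω₃ = 0 then 1 / √(ω₁ * ω₂)
  else min (min (√ω₁) (√ω₂)) (min (√ω₃) (√(ω₁ + ω₂ - ω₃))) / √(ω₁ * ω₂ * ω₃)

/-- The weak collision integral of the measure `μ` against the test function `φ`. The kernel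
vanishes where `ω₁ + ω₂ - ω₃ < 0`, so only values of `φ` on `[0, ∞)` enter. -/
def collision (μ : Measure ℝ) (φ : ℝ → ℝ) : ℝ :=
  ∫ p : ℝ × ℝ × ℝ, kernel p.1 p.2.1 p.2.2 *
    (φ (p.1 + p.2.1 - p.2.2) + φ p.2.2 - φ p.1 - φ p.2.1) ∂(μ.prod (μ.prod μ))

/-- `g(t) = √ω f(t)` is (the measure attached to) a nonnegative weak solution, conserving mass
and energy, of the radial 4-wave kinetic equation with initial data `f₀`. -/
structure IsWeakSolution (ρ : ℝ) (f₀ : Measure ℝ) (g : ℝ → Measure ℝ) : Prop where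
  mem : ∀ t, 0 ≤ t → MemMRho ρ (g t)
  /-- Continuity in time for the weak topology of measures on `[0, ∞)`. -/
  cont : ∀ ψ : ℝ → ℝ, Continuous ψ → HasCompactSupport ψ →
    ContinuousOn (fun t => ∫ ω, ψ ω ∂(g t)) (Ici 0)
  /-- The weak formulation; `φ t ω` is `C²` with compact support. -/
  weak : ∀ φ : ℝ → ℝ → ℝ, ContDiff ℝ 2 (Function.uncurry φ) →
    HasCompactSupport (Function.uncurry φ) → ∀ T : ℝ, 0 < T →
      (∫ ω, φ T ω ∂(g T)) - ∫ ω, φ 0 ω ∂(sqrtMul f₀)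
        = (∫ t in (0 : ℝ)..T, ∫ ω, deriv (fun s => φ s ω) t ∂(g t))
          + ∫ t in (0 : ℝ)..T, collision (g t) (φ t)
  mass : ∀ t, 0 < t → g t univ = sqrtMul f₀ univ
  energy : ∀ t, 0 < t →
    ∫⁻ ω, ENNReal.ofReal ω ∂(g t) = ∫⁻ ω, ENNReal.ofReal ω ∂(sqrtMul f₀)

/-- The singular Rayleigh-Jeans measure `A ω⁻¹ dω` on `(0, ∞)`. -/
def rayleighJeans (A : ℝ) : Measure ℝ :=
  (volume.restrict (Ioi 0)).withDensity fun ω => ENNReal.ofReal (A * ω⁻¹)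

/-- `f₀ = A ω⁻¹ 1_{0 < ω < B} + min (A ω⁻¹, g₀ / √ω) 1_{ω > B}`. As `g₀` is a measure, the minimum
is the infimum of two measures; if `g₀ = h dω`, it is the measure with
density `min (A ω⁻¹, h(ω) / √ω)`. -/
def initialData (A B : ℝ) (g₀ : Measure ℝ) : Measure ℝ :=
  (rayleighJeans A).restrict (Ioo 0 B)
    + (rayleighJeans A ⊓ g₀.withDensity fun ω => ENNReal.ofReal (1 / √ω)).restrict (Ioi B)

end WaveKinetic

end

/-!
Testing the equation against the convex function `(1 - ω / r)₊³` gives a smoothed mass of `[0, r]`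
which is nondecreasing in time: summed over the cyclic permutations of the three frequencies, the
collision integrand is at least a multiple of a second difference of the test function. The same
second difference bounds the growth rate from below by `c r⁻¹ μ([0, r / 16]) μ((r / 4, r])²`.

Suppose that the mass of `[0, r]` is at least `N √r` for all small `r`, as it is initially with
`N` of order `A`, and that there is no atom at `0` up to a given time. The dyadic shells
`(r / 4 ^ (k + 1), r / 4 ^ k]` then carry all the mass of `[0, r]`, and Cauchy-Schwarz over the
shells shows that a weighted sum of the growth rates is at least of order `N³ √r`. So `N` doubles
within a time of order `N⁻²`. These times form a convergent geometric series of sum of order `A⁻²`,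
and by then the mass would be infinite.
-/

noncomputable section

namespace WaveKinetic

open Filter
open scoped NNReal Topology

/-! ### The collision kernel -/

lemma kernel_nonneg (x y z : ℝ) : 0 ≤ kernel x y z := by
  unfold kernel
  split_ifs <;> positivity

lemma kernel_comm (x y z : ℝ) : kernel x y z = kernel y x z := by
  unfold kernel
  by_cases hx : x = 0 <;> by_cases hy : y = 0
  · simp [hx, hy]
  · simp [hx, hy]
  · simp [hx, hy]
  · simp only [hx, hy, if_false]
    rw [min_comm (√x), mul_comm x y, add_comm x y]

lemma measurable_kernel : Measurable fun p : ℝ × ℝ × ℝ => kernel p.1 p.2.1 p.2.2 := by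
  have h1 : Measurable fun p : ℝ × ℝ × ℝ => p.1 := by fun_prop
  have h2 : Measurable fun p : ℝ × ℝ × ℝ => p.2.1 := by fun_prop
  have h3 : Measurable fun p : ℝ × ℝ × ℝ => p.2.2 := by fun_prop
  unfold kernel
  refine Measurable.ite (measurableSet_eq_fun h1 measurable_const)
    (Measurable.ite (measurableSet_le h3 h2) (by fun_prop) (by fun_prop)) ?_
  refine Measurable.ite (measurableSet_eq_fun h2 measurable_const)
    (Measurable.ite (measurableSet_le h3 h1) (by fun_prop) (by fun_prop)) ?_
  exact Measurable.ite (measurableSet_eq_fun h3 measurable_const) (by fun_prop) (by fun_prop)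

lemma kernel_eq_zero_of_add_lt {x y z : ℝ} (hx : 0 ≤ x) (hy : 0 ≤ y) (h : x + y < z) :
    kernel x y z = 0 := by
  unfold kernel
  split_ifs
  · linarith
  · rfl
  · linarith
  · rfl
  · linarith
  · rw [Real.sqrt_eq_zero'.mpr (by linarith : x + y - z ≤ 0)]
    simp [Real.sqrt_nonneg]

lemma sqrt_div_sqrt_mul {a : ℝ} (ha : 0 < a) (s : ℝ) : √a / √(a * s) = 1 / √s := by
  rw [Real.sqrt_mul ha.le, div_mul_cancel_left₀ (Real.sqrt_pos.mpr ha).ne', one_div]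

section Sorted

variable {a b c : ℝ} (ha : 0 ≤ a) (hab : a ≤ b) (hbc : b ≤ c)
include ha hab hbc

lemma kernel_of_third_min : kernel b c a = 1 / √(b * c) := by
  rcases ha.eq_or_lt with rfl | ha
  · rcases hab.eq_or_lt with rfl | hb
    · simp [kernel]
    · simp [kernel, hb.ne', (hb.trans_le hbc).ne']
  · have hb := ha.trans_le hab
    have hΦ : min (min √b √c) (min √a √(b + c - a)) = √a := by
      rw [min_eq_left (Real.sqrt_le_sqrt (by linarith : a ≤ b + c - a)),
        min_eq_right (le_min (Real.sqrt_le_sqrt hab) (Real.sqrt_le_sqrt (hab.trans hbc)))]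
    simp only [kernel, ha.ne', hb.ne', (hb.trans_le hbc).ne', if_false]
    rw [hΦ, mul_comm, sqrt_div_sqrt_mul ha]

lemma kernel_of_third_mid : kernel c a b = 1 / √(b * c) := by
  rcases ha.eq_or_lt with rfl | ha
  · rcases (hab.trans hbc).eq_or_lt with rfl | hc
    · obtain rfl : b = 0 := le_antisymm hbc hab
      simp [kernel]
    · simp [kernel, hc.ne', hbc, mul_comm]
  · have hb := ha.trans_le hab
    have hΦ : min (min √c √a) (min √b √(c + a - b)) = √a := by
      rw [min_eq_right (Real.sqrt_le_sqrt (hab.trans hbc)),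
        min_eq_left (le_min (Real.sqrt_le_sqrt hab) (Real.sqrt_le_sqrt (by linarith)))]
    simp only [kernel, ha.ne', hb.ne', (hb.trans_le hbc).ne', if_false]
    rw [hΦ, show c * a * b = a * (b * c) by ring, sqrt_div_sqrt_mul ha]

lemma kernel_le_of_third_max : kernel a b c ≤ 1 / √(b * c) := by
  rcases ha.eq_or_lt with rfl | ha
  · simp only [kernel, if_true]
    split_ifs
    · exact le_rfl
    · positivity
  · have hb := ha.trans_le hab
    simp only [kernel, ha.ne', hb.ne', (hb.trans_le hbc).ne', if_false]
    rw [← sqrt_div_sqrt_mul ha, mul_assoc]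
    gcongr
    exact (min_le_left _ _).trans (min_le_left _ _)

end Sorted

lemma one_div_sqrt_mul_mul_le_one {u b c : ℝ} (hu : 0 ≤ u) (hub : u ≤ b) (hbc : b ≤ c) :
    1 / √(b * c) * u ≤ 1 := by
  have h : u ≤ √(b * c) := Real.le_sqrt_of_sq_le (by nlinarith)
  rw [one_div_mul_eq_div]
  exact div_le_one_of_le₀ h (Real.sqrt_nonneg _)

lemma kernel_mul_min_abs_sub_le_one {x y z : ℝ} (hx : 0 ≤ x) (hy : 0 ≤ y) (hz : 0 ≤ z) :
    kernel x y z * min |x - z| |y - z| ≤ 1 := by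
  wlog hxy : x ≤ y generalizing x y
  · rw [kernel_comm, min_comm]
    exact this hy hx (le_of_not_ge hxy)
  rcases lt_or_ge (x + y) z with hw | hw
  · simp [kernel_eq_zero_of_add_lt hx hy hw]
  have of_le : ∀ {u b c : ℝ}, kernel x y z ≤ 1 / √(b * c) → min |x - z| |y - z| ≤ |u| →
      |u| ≤ b → b ≤ c → kernel x y z * min |x - z| |y - z| ≤ 1 := fun hk hm hub hbc =>
    (mul_le_mul hk hm (by positivity) (by positivity)).trans
      (one_div_sqrt_mul_mul_le_one (abs_nonneg _) hub hbc)
  rcases le_total z x with hzx | hxz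
  · exact of_le (kernel_of_third_min hz hzx hxy).le (min_le_left _ _)
      (abs_le.mpr ⟨by linarith, by linarith⟩) hxy
  rcases le_total z y with hzy | hyz
  · exact of_le (kernel_comm x y z ▸ kernel_of_third_mid hx hxz hzy).le (min_le_left _ _)
      (abs_le.mpr ⟨by linarith, by linarith⟩) hzy
  · exact of_le (kernel_le_of_third_max hx hxy hyz) (min_le_right _ _)
      (abs_le.mpr ⟨by linarith, by linarith⟩) hyz

/-! ### The collision integrand -/

/-- The integrand of `collision`, as a function of the frequencies `ω₁`, `ω₂`, `ω₃`. -/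
def integrand (f : ℝ → ℝ) (x y z : ℝ) : ℝ :=
  kernel x y z * (f (x + y - z) + f z - f x - f y)

section Integrand

variable {f : ℝ → ℝ} {x y z : ℝ}

lemma integrand_comm (f : ℝ → ℝ) (x y z : ℝ) : integrand f x y z = integrand f y x z := by
  unfold integrand
  rw [kernel_comm, add_comm x y]
  ring

lemma integrand_congr {h : ℝ → ℝ} (hfh : EqOn f h (Ici 0)) (hx : 0 ≤ x) (hy : 0 ≤ y)
    (hz : 0 ≤ z) : integrand f x y z = integrand h x y z := by
  unfold integrand
  rcases lt_or_ge (x + y) z with hw | hw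
  · simp [kernel_eq_zero_of_add_lt hx hy hw]
  · rw [hfh hx, hfh hy, hfh hz, hfh (sub_nonneg.mpr hw)]

lemma measurable_integrand (hf : Measurable f) :
    Measurable fun p : ℝ × ℝ × ℝ => integrand f p.1 p.2.1 p.2.2 :=
  measurable_kernel.mul (by fun_prop)

lemma abs_add_sub_sub_le_of_lipschitzOnWith {K : ℝ≥0} {s : Set ℝ} (hf : LipschitzOnWith K f s)
    (hx : x ∈ s) (hy : y ∈ s) (hz : z ∈ s) (hw : x + y - z ∈ s) :
    |f (x + y - z) + f z - f x - f y| ≤ 2 * K * min |x - z| |y - z| := by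
  have le_left : ∀ {x y : ℝ}, x ∈ s → y ∈ s → x + y - z ∈ s →
      |f (x + y - z) + f z - f x - f y| ≤ 2 * K * |x - z| := by
    intro x y hx hy hw
    have h1 := hf.dist_le_mul _ hw _ hy
    have h2 := hf.dist_le_mul _ hx _ hz
    simp only [Real.dist_eq, show x + y - z - y = x - z by ring] at h1 h2
    calc _ = |(f (x + y - z) - f y) - (f x - f z)| := by ring_nf
      _ ≤ |f (x + y - z) - f y| + |f x - f z| := abs_sub _ _
      _ ≤ _ := by linarith
  rw [mul_min_of_nonneg _ _ (by positivity)]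
  refine le_min (le_left hx hy hw) ?_
  have h := le_left hy hx (by rwa [add_comm])
  rwa [add_comm y x, sub_right_comm] at h

lemma abs_integrand_le {K : ℝ≥0} (hf : LipschitzOnWith K f (Ici 0)) (hx : 0 ≤ x) (hy : 0 ≤ y)
    (hz : 0 ≤ z) : |integrand f x y z| ≤ 2 * K := by
  rcases lt_or_ge (x + y) z with hw | hw
  · simp [integrand, kernel_eq_zero_of_add_lt hx hy hw]
  rw [integrand, abs_mul, abs_of_nonneg (kernel_nonneg x y z)]
  calc _ ≤ kernel x y z * (2 * K * min |x - z| |y - z|) := by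
        gcongr
        · exact kernel_nonneg x y z
        · exact abs_add_sub_sub_le_of_lipschitzOnWith hf hx hy hz (sub_nonneg.mpr hw)
    _ = 2 * K * (kernel x y z * min |x - z| |y - z|) := by ring
    _ ≤ 2 * K := mul_le_of_le_one_right (by positivity) (kernel_mul_min_abs_sub_le_one hx hy hz)

end Integrand

lemma add_le_add_of_convexOn_of_mem_segment {E : Type*} [AddCommGroup E] [Module ℝ E] {s : Set E}
    {f : E → ℝ} (hf : ConvexOn ℝ s f) {u v x y : E} (hu : u ∈ s) (hv : v ∈ s)
    (hx : x ∈ segment ℝ u v) (h : x + y = u + v) : f x + f y ≤ f u + f v := by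
  obtain ⟨a, b, ha, hb, hab, rfl⟩ := hx
  obtain rfl : y = b • u + a • v := by
    rw [← eq_sub_iff_add_eq'] at h
    obtain rfl : b = 1 - a := by linarith
    rw [h]
    module
  have h1 := hf.2 hu hv ha hb hab
  have h2 := hf.2 hu hv hb ha (by rwa [add_comm])
  calc _ ≤ (a • f u + b • f v) + (b • f u + a • f v) := add_le_add h1 h2
    _ = (a + b) * (f u + f v) := by simp only [smul_eq_mul]; ring
    _ = f u + f v := by rw [hab, one_mul]

/-- The sum of the collision integrand over the cyclic permutations of its arguments. Unlike
`integrand` itself it has a sign when `f` is convex, and it has the same integral up to a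
factor `3`. -/
def symIntegrand (f : ℝ → ℝ) (x y z : ℝ) : ℝ :=
  integrand f x y z + integrand f y z x + integrand f z x y

lemma symIntegrand_swap (f : ℝ → ℝ) (x y z : ℝ) :
    symIntegrand f x y z = symIntegrand f y x z := by
  unfold symIntegrand
  rw [integrand_comm f x y z, integrand_comm f y z x, integrand_comm f z x y]
  ring

lemma symIntegrand_rotate (f : ℝ → ℝ) (x y z : ℝ) :
    symIntegrand f x y z = symIntegrand f y z x := by
  unfold symIntegrand
  ring

section Convex

variable {f : ℝ → ℝ} (hf : ConvexOn ℝ (Ici 0) f)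
include hf

lemma integrand_nonneg_of_third_max {a b c : ℝ} (ha : 0 ≤ a) (hab : a ≤ b) (hbc : b ≤ c) :
    0 ≤ integrand f a b c := by
  rcases lt_or_ge (a + b) c with hw | hw
  · simp [integrand, kernel_eq_zero_of_add_lt ha (ha.trans hab) hw]
  refine mul_nonneg (kernel_nonneg _ _ _) ?_
  have ha' : a ∈ segment ℝ (a + b - c) c := by
    rw [segment_eq_Icc (by linarith)]
    exact ⟨by linarith, hab.trans hbc⟩
  have := add_le_add_of_convexOn_of_mem_segment hf (sub_nonneg.mpr hw)
    (ha.trans (hab.trans hbc)) ha' (show a + b = a + b - c + c by ring)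
  linarith

lemma le_symIntegrand_of_sorted {a b c : ℝ} (ha : 0 ≤ a) (hab : a ≤ b) (hbc : b ≤ c) :
    1 / √(b * c) * (f (c + (b - a)) + f (c - (b - a)) - 2 * f c) ≤ symIntegrand f a b c := by
  have h : integrand f b c a + integrand f c a b
      = 1 / √(b * c) * (f (c + (b - a)) + f (c - (b - a)) - 2 * f c) := by
    rw [integrand, integrand, kernel_of_third_min ha hab hbc, kernel_of_third_mid ha hab hbc,
      show b + c - a = c + (b - a) by ring, show c + a - b = c - (b - a) by ring]
    ring
  rw [symIntegrand, ← h]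
  linarith [integrand_nonneg_of_third_max hf ha hab hbc]

lemma symIntegrand_nonneg {x y z : ℝ} (hx : 0 ≤ x) (hy : 0 ≤ y) (hz : 0 ≤ z) :
    0 ≤ symIntegrand f x y z := by
  have of_sorted : ∀ {a b c : ℝ}, 0 ≤ a → a ≤ b → b ≤ c → 0 ≤ symIntegrand f a b c := by
    intro a b c ha hab hbc
    refine le_trans (mul_nonneg (by positivity) ?_) (le_symIntegrand_of_sorted hf ha hab hbc)
    have hc : c ∈ segment ℝ (c - (b - a)) (c + (b - a)) := by
      rw [segment_eq_Icc (by linarith)]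
      exact ⟨by linarith, by linarith⟩
    have := add_le_add_of_convexOn_of_mem_segment hf (show 0 ≤ c - (b - a) by linarith)
      (show 0 ≤ c + (b - a) by linarith) hc (show c + c = _ by ring)
    linarith
  wlog hxy : x ≤ y generalizing x y
  · rw [symIntegrand_swap]
    exact this hy hx (le_of_not_ge hxy)
  rcases le_total z x with hzx | hxz
  · rw [symIntegrand_rotate, symIntegrand_rotate]
    exact of_sorted hz hzx hxy
  rcases le_total z y with hzy | hyz
  · rw [symIntegrand_swap, symIntegrand_rotate]
    exact of_sorted hx hxz hzy
  · exact of_sorted hx hxy hyz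

end Convex

/-! ### The cubic test function -/

/-- The test function `(1 - ω / r)₊³`. It is convex, decreasing and vanishes beyond `r`, and the
exponent is the smallest one which makes it `C²`. -/
def cubic (r ω : ℝ) : ℝ := max 0 (1 - ω / r) ^ 3

section Cubic

variable {r : ℝ}

lemma cubic_nonneg (r ω : ℝ) : 0 ≤ cubic r ω := by
  unfold cubic; positivity

lemma continuous_cubic (r : ℝ) : Continuous (cubic r) := by
  unfold cubic; fun_prop

lemma convexOn_cubic (r : ℝ) {s : Set ℝ} (hs : Convex ℝ s) : ConvexOn ℝ s (cubic r) := by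
  refine ConvexOn.pow ?_ (fun x _ => le_max_left _ _) 3
  refine (convexOn_const 0 hs).sup ⟨hs, fun x _ y _ a b _ _ hab => le_of_eq ?_⟩
  obtain rfl : b = 1 - a := by linarith
  simp only [smul_eq_mul]
  ring

lemma cubic_zero_right (r : ℝ) : cubic r 0 = 1 := by
  simp [cubic]

lemma cubic_le_one {ω : ℝ} (hr : 0 ≤ r) (hω : 0 ≤ ω) : cubic r ω ≤ 1 := by
  have : 0 ≤ ω / r := by positivity
  exact pow_le_one₀ (le_max_left _ _) (max_le zero_le_one (by linarith))

lemma cubic_eq_zero_of_le {ω : ℝ} (hr : 0 < r) (hω : r ≤ ω) : cubic r ω = 0 := by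
  have : 1 ≤ ω / r := (one_le_div hr).mpr hω
  simp [cubic, max_eq_left (show 1 - ω / r ≤ 0 by linarith)]

lemma cubic_mono_left {s ω : ℝ} (hr : 0 < r) (hrs : r ≤ s) (hω : 0 ≤ ω) :
    cubic r ω ≤ cubic s ω := by
  have : ω / s ≤ ω / r := div_le_div_of_nonneg_left hω hr hrs
  unfold cubic
  gcongr

lemma one_eighth_le_cubic {ω : ℝ} (hr : 0 < r) (hω : ω ≤ r / 2) : 1 / 8 ≤ cubic r ω := by
  have : ω / r ≤ 1 / 2 := by rw [div_le_iff₀ hr]; linarith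
  have h : (1 / 2 : ℝ) ≤ max 0 (1 - ω / r) := le_max_of_le_right (by linarith)
  calc (1 / 8 : ℝ) = (1 / 2) ^ 3 := by norm_num
    _ ≤ _ := by unfold cubic; gcongr

lemma cube_le_max_zero_secondDiff {x k : ℝ} (hx : 0 ≤ x) (hk : 0 ≤ k) :
    k ^ 3 ≤ max 0 (x - k) ^ 3 + max 0 (x + k) ^ 3 - 2 * max 0 x ^ 3 := by
  rw [max_eq_right hx, max_eq_right (by linarith : 0 ≤ x + k)]
  rcases le_total x k with hxk | hxk
  · rw [max_eq_left (by linarith)]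
    have : x * x * x ≤ x * x * k := by gcongr
    have : 0 ≤ x * x * k := by positivity
    have : 0 ≤ x * k * k := by positivity
    nlinarith
  · rw [max_eq_right (by linarith)]
    have : k * k * k ≤ x * k * k := by gcongr
    have : 0 ≤ k * k * k := by positivity
    nlinarith

lemma cube_le_cubic_secondDiff {c h : ℝ} (hr : 0 < r) (hc : c ≤ r) (hh : 0 ≤ h) :
    (h / r) ^ 3 ≤ cubic r (c + h) + cubic r (c - h) - 2 * cubic r c := by
  have hx : 0 ≤ 1 - c / r := sub_nonneg.mpr ((div_le_one hr).mpr hc)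
  convert cube_le_max_zero_secondDiff hx (show 0 ≤ h / r by positivity) using 5 <;>
    (unfold cubic; ring_nf)

lemma le_symIntegrand_cubic {x y z : ℝ} (hr : 0 < r) (hx : x ∈ Icc 0 (r / 16))
    (hy : y ∈ Ioc (r / 4) r) (hz : z ∈ Ioc (r / 4) r) :
    1 / (512 * r) ≤ symIntegrand (cubic r) x y z := by
  wlog hyz : y ≤ z generalizing y z
  · rw [symIntegrand_swap, symIntegrand_rotate]
    exact this hz hy (le_of_not_ge hyz)
  have hy0 : 0 < y := by linarith [hy.1]
  have hxy : r / 8 ≤ y - x := by linarith [hy.1, hx.2]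
  have hkernel : 1 / r ≤ 1 / √(y * z) := by
    have : 0 < √(y * z) := Real.sqrt_pos.mpr (mul_pos hy0 (hy0.trans_le hyz))
    gcongr
    rw [Real.sqrt_le_left hr.le]
    nlinarith [hy.2, hz.2]
  have hstep : (1 / 8 : ℝ) ≤ (y - x) / r := by rw [le_div_iff₀ hr]; linarith
  calc 1 / (512 * r) = 1 / r * (1 / 8) ^ 3 := by field_simp; norm_num
    _ ≤ 1 / √(y * z) * ((y - x) / r) ^ 3 := by gcongr
    _ ≤ 1 / √(y * z) * (cubic r (z + (y - x)) + cubic r (z - (y - x)) - 2 * cubic r z) := by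
        gcongr
        exact cube_le_cubic_secondDiff hr hz.2 (by linarith)
    _ ≤ symIntegrand (cubic r) x y z :=
        le_symIntegrand_of_sorted (convexOn_cubic r (convex_Ici 0)) hx.1 (by linarith) hyz

end Cubic

lemma hasDerivAt_max_zero_pow (n : ℕ) (x : ℝ) :
    HasDerivAt (fun u : ℝ => max 0 u ^ (n + 2)) ((n + 2) * max 0 x ^ (n + 1)) x := by
  rcases lt_trichotomy x 0 with hx | rfl | hx
  · have h : (fun u : ℝ => max 0 u ^ (n + 2)) =ᶠ[𝓝 x] fun _ => 0 := by
      filter_upwards [Iio_mem_nhds hx] with u (hu : u < 0)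
      simp [max_eq_left hu.le]
    rw [max_eq_left hx.le]
    simpa using (hasDerivAt_const x (0 : ℝ)).congr_of_eventuallyEq h
  · have h1 : (fun u : ℝ => max 0 u ^ (n + 2)) =O[𝓝 0] fun u => u ^ (n + 2) := by
      refine Asymptotics.IsBigO.of_bound 1 (Eventually.of_forall fun u => ?_)
      rw [one_mul, norm_pow, norm_pow]
      gcongr
      rw [Real.norm_eq_abs, Real.norm_eq_abs, abs_of_nonneg (le_max_left _ _)]
      exact max_le (abs_nonneg _) (le_abs_self _)
    have h2 : (fun u : ℝ => u ^ (n + 2)) =o[𝓝 0] fun u => u := by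
      simpa using Asymptotics.isLittleO_pow_pow (𝕜 := ℝ) (show 1 < n + 2 by omega)
    rw [hasDerivAt_iff_isLittleO_nhds_zero]
    simpa using h1.trans_isLittleO h2
  · have h : (fun u : ℝ => max 0 u ^ (n + 2)) =ᶠ[𝓝 x] fun u => u ^ (n + 2) := by
      filter_upwards [Ioi_mem_nhds hx] with u (hu : 0 < u)
      rw [max_eq_right hu.le]
    rw [max_eq_right hx.le]
    simpa using (hasDerivAt_pow (n + 2) x).congr_of_eventuallyEq h

lemma contDiff_max_zero_pow (n : ℕ) : ContDiff ℝ n fun u : ℝ => max 0 u ^ (n + 1) := by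
  induction n with
  | zero => exact contDiff_zero.mpr (by fun_prop)
  | succ n ih =>
    rw [Nat.cast_succ, contDiff_succ_iff_deriv]
    refine ⟨fun x => (hasDerivAt_max_zero_pow n x).differentiableAt, by simp, ?_⟩
    rw [show deriv (fun u : ℝ => max 0 u ^ (n + 1 + 1)) =
        fun u : ℝ => ((n : ℝ) + 2) * max 0 u ^ (n + 1) from
      funext fun x => (hasDerivAt_max_zero_pow n x).deriv]
    exact contDiff_const.mul ih

lemma exists_contDiff_eventuallyEq_one_closedBall {E : Type*} [NormedAddCommGroup E]
    [NormedSpace ℝ E] [FiniteDimensional ℝ E] [HasContDiffBump E] (c : E) (R : ℝ) (n : ℕ∞) :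
    ∃ χ : E → ℝ, ContDiff ℝ n χ ∧ HasCompactSupport χ ∧
      ∀ x ∈ Metric.closedBall c R, χ =ᶠ[𝓝 x] 1 := by
  let χ : ContDiffBump c := ⟨|R| + 1, |R| + 2, by positivity, by linarith⟩
  refine ⟨χ, χ.contDiff, χ.hasCompactSupport, fun x hx => χ.eventuallyEq_one_of_mem_ball ?_⟩
  exact lt_of_le_of_lt (Metric.mem_closedBall.mp hx) ((le_abs_self R).trans_lt (lt_add_one _))

lemma exists_contDiff_eqOn_cubic {r : ℝ} (hr : 0 < r) :
    ∃ φ : ℝ → ℝ, ContDiff ℝ 2 φ ∧ HasCompactSupport φ ∧ EqOn φ (cubic r) (Ici 0) := by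
  obtain ⟨χ, hχ, hχc, hχ1⟩ := exists_contDiff_eventuallyEq_one_closedBall (0 : ℝ) r 2
  refine ⟨fun ω => cubic r ω * χ ω, ?_, hχc.mul_left, fun ω (hω : 0 ≤ ω) => ?_⟩
  · exact ((contDiff_max_zero_pow 2).comp (contDiff_const.sub (contDiff_id.div_const r))).mul hχ
  · rcases le_total ω r with h | h
    · have : χ ω = 1 := (hχ1 ω (by simpa [abs_of_nonneg hω] using h)).eq_of_nhds
      simp only [this, mul_one]
    · simp only [cubic_eq_zero_of_le hr h, zero_mul]

lemma exists_lipschitzOnWith_cubic {r : ℝ} (hr : 0 < r) :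
    ∃ K, LipschitzOnWith K (cubic r) (Ici 0) := by
  obtain ⟨φ, hφ, hc, he⟩ := exists_contDiff_eqOn_cubic hr
  obtain ⟨K, hK⟩ := ContDiff.lipschitzWith_of_hasCompactSupport hc hφ two_ne_zero
  exact ⟨K, fun x hx y hy => by rw [← he hx, ← he hy]; exact hK x y⟩

/-! ### Finite mass -/

lemma MemMRho.ae_nonneg {ρ : ℝ} {μ : Measure ℝ} (h : MemMRho ρ μ) : ∀ᵐ x ∂μ, 0 ≤ x := by
  rw [ae_iff]
  simpa [Iio_def] using h.1

lemma ae_nonneg_sqrtMul (f : Measure ℝ) : ∀ᵐ x ∂(sqrtMul f), 0 ≤ x := by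
  rw [sqrtMul, ae_withDensity_iff (by fun_prop)]
  refine Eventually.of_forall fun x hx => ?_
  rw [ne_eq, ENNReal.ofReal_eq_zero, not_le, Real.sqrt_pos] at hx
  exact hx.le

lemma measure_Icc_le_rhoNorm {R : ℝ} (hR : 1 < R) (ρ : ℝ) (μ : Measure ℝ) :
    μ (Icc (R / 2) R) ≤ ENNReal.ofReal ((1 + R) ^ ρ * R) * rhoNorm ρ μ := by
  have : 0 < R := by linarith
  have : 0 < (1 + R) ^ ρ := Real.rpow_pos_of_pos (by linarith) ρ
  have hterm : ENNReal.ofReal (1 / (1 + R) ^ ρ * (1 / R)) * μ (Icc (R / 2) R) ≤ rhoNorm ρ μ :=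
    (le_iSup₂ (f := fun (R : ℝ) (_ : R ∈ Ioi (1 : ℝ)) =>
      ENNReal.ofReal (1 / (1 + R) ^ ρ * (1 / R)) * μ (Icc (R / 2) R)) R hR).trans le_self_add
  have hinv : ENNReal.ofReal ((1 + R) ^ ρ * R) * ENNReal.ofReal (1 / (1 + R) ^ ρ * (1 / R))
      = 1 := by
    rw [← ENNReal.ofReal_mul (by positivity), ← ENNReal.ofReal_one]
    congr 1
    field_simp
  calc μ (Icc (R / 2) R) = ENNReal.ofReal ((1 + R) ^ ρ * R) *
        (ENNReal.ofReal (1 / (1 + R) ^ ρ * (1 / R)) * μ (Icc (R / 2) R)) := by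
          rw [← mul_assoc, hinv, one_mul]
    _ ≤ _ := by gcongr

lemma one_add_rpow_mul_le {ρ R : ℝ} (hρ : ρ ≤ 0) (hR : 0 < R) :
    (1 + R) ^ ρ * R ≤ R ^ (ρ + 1) := by
  rw [Real.rpow_add_one hR.ne']
  exact mul_le_mul_of_nonneg_right (Real.rpow_le_rpow_of_nonpos hR (by linarith) hρ) hR.le

lemma Ioi_one_subset_iUnion_Icc_two_pow :
    Ioi (1 : ℝ) ⊆ ⋃ k : ℕ, Icc ((2 : ℝ) ^ (k + 1) / 2) (2 ^ (k + 1)) := by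
  intro x hx
  obtain ⟨k, hk1, hk2⟩ := exists_nat_pow_near (le_of_lt hx) (one_lt_two : (1 : ℝ) < 2)
  refine mem_iUnion.mpr ⟨k, ?_, hk2.le⟩
  rwa [pow_succ, mul_div_cancel_right₀ _ two_ne_zero]

lemma measure_Ioi_one_le_rhoNorm {ρ : ℝ} (hρ : ρ ≤ 0) (μ : Measure ℝ) :
    μ (Ioi 1) ≤ (∑' k : ℕ, ENNReal.ofReal (2 ^ (ρ + 1)) ^ (k + 1)) * rhoNorm ρ μ := by
  rw [← ENNReal.tsum_mul_right]
  refine (measure_mono Ioi_one_subset_iUnion_Icc_two_pow).trans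
    ((measure_iUnion_le _).trans (ENNReal.tsum_le_tsum fun k => ?_))
  refine (measure_Icc_le_rhoNorm (one_lt_pow₀ one_lt_two k.succ_ne_zero) ρ μ).trans ?_
  rw [← ENNReal.ofReal_pow (by positivity)]
  gcongr
  refine (one_add_rpow_mul_le hρ (by positivity)).trans (le_of_eq ?_)
  rw [← Real.rpow_natCast, ← Real.rpow_natCast, ← Real.rpow_mul zero_le_two,
    ← Real.rpow_mul zero_le_two, mul_comm]

lemma MemMRho.isFiniteMeasure {ρ : ℝ} (hρ : ρ < -1) {μ : Measure ℝ} (h : MemMRho ρ μ) :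
    IsFiniteMeasure μ := by
  have hcover : (univ : Set ℝ) ⊆ Iio 0 ∪ Icc 0 1 ∪ Ioi 1 := fun x _ => by
    rcases lt_or_ge x 0 with h0 | h0
    · exact Or.inl (Or.inl h0)
    · exact (le_or_gt x 1).imp (fun h1 => Or.inr ⟨h0, h1⟩) id
  have hq : ENNReal.ofReal (2 ^ (ρ + 1)) < 1 := ENNReal.ofReal_lt_one.mpr
    (Real.rpow_lt_one_of_one_lt_of_neg one_lt_two (by linarith))
  refine ⟨(measure_mono hcover).trans_lt (measure_union_lt_top (measure_union_lt_top ?_ ?_) ?_)⟩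
  · simp [h.1]
  · exact lt_of_le_of_lt le_add_self h.2
  · refine (measure_Ioi_one_le_rhoNorm (by linarith) μ).trans_lt (ENNReal.mul_lt_top ?_ h.2)
    simp only [pow_succ, ENNReal.tsum_mul_right, ENNReal.tsum_geometric]
    exact ENNReal.mul_lt_top (ENNReal.inv_lt_top.mpr (tsub_pos_of_lt hq)) ENNReal.ofReal_lt_top

/-! ### The collision integral -/

section Collision

variable {μ : Measure ℝ} {f : ℝ → ℝ}

lemma ae_prod_nonneg [SFinite μ] (hμ : ∀ᵐ x ∂μ, 0 ≤ x) :
    ∀ᵐ p : ℝ × ℝ × ℝ ∂(μ.prod (μ.prod μ)), 0 ≤ p.1 ∧ 0 ≤ p.2.1 ∧ 0 ≤ p.2.2 := by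
  have hsnd : Measure.QuasiMeasurePreserving (Prod.snd : ℝ × ℝ × ℝ → ℝ × ℝ) (μ.prod (μ.prod μ))
    (μ.prod μ) := Measure.quasiMeasurePreserving_snd
  filter_upwards [Measure.quasiMeasurePreserving_fst.ae hμ,
    (Measure.quasiMeasurePreserving_fst.comp hsnd).ae hμ,
    (Measure.quasiMeasurePreserving_snd.comp hsnd).ae hμ] with p h1 h2 h3
  exact ⟨h1, h2, h3⟩

lemma collision_eq_integral (μ : Measure ℝ) (f : ℝ → ℝ) :
    collision μ f = ∫ p : ℝ × ℝ × ℝ, integrand f p.1 p.2.1 p.2.2 ∂(μ.prod (μ.prod μ)) := rfl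

lemma collision_congr [SFinite μ] (hμ : ∀ᵐ x ∂μ, 0 ≤ x) {h : ℝ → ℝ} (hfh : EqOn f h (Ici 0)) :
    collision μ f = collision μ h := by
  rw [collision_eq_integral, collision_eq_integral]
  refine integral_congr_ae ?_
  filter_upwards [ae_prod_nonneg hμ] with p hp
  exact integrand_congr hfh hp.1 hp.2.1 hp.2.2

lemma measurePreserving_prodComm_trans_prodAssoc {α : Type*} [MeasurableSpace α] (μ : Measure α)
    [SFinite μ] :
    MeasurePreserving ((MeasurableEquiv.prodComm (α := α) (β := α × α)).trans
      MeasurableEquiv.prodAssoc) (μ.prod (μ.prod μ)) (μ.prod (μ.prod μ)) :=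
  (measurePreserving_prodAssoc μ μ μ).comp Measure.measurePreserving_swap

lemma integral_prod_rotate {α : Type*} [MeasurableSpace α] (μ : Measure α) [SFinite μ]
    (F : α → α → α → ℝ) :
    ∫ p : α × α × α, F p.2.1 p.2.2 p.1 ∂(μ.prod (μ.prod μ))
      = ∫ p : α × α × α, F p.1 p.2.1 p.2.2 ∂(μ.prod (μ.prod μ)) :=
  (measurePreserving_prodComm_trans_prodAssoc μ).integral_comp' fun p => F p.1 p.2.1 p.2.2

lemma integrable_prod_rotate {α : Type*} [MeasurableSpace α] {μ : Measure α} [SFinite μ]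
    {F : α → α → α → ℝ}
    (hF : Integrable (fun p : α × α × α => F p.1 p.2.1 p.2.2) (μ.prod (μ.prod μ))) :
    Integrable (fun p : α × α × α => F p.2.1 p.2.2 p.1) (μ.prod (μ.prod μ)) :=
  (measurePreserving_prodComm_trans_prodAssoc μ).integrable_comp_of_integrable hF

variable [IsFiniteMeasure μ]

lemma integrable_integrand (hμ : ∀ᵐ x ∂μ, 0 ≤ x) (hf : Measurable f) {K : ℝ≥0}
    (hK : LipschitzOnWith K f (Ici 0)) :
    Integrable (fun p : ℝ × ℝ × ℝ => integrand f p.1 p.2.1 p.2.2) (μ.prod (μ.prod μ)) := by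
  refine Integrable.of_bound (measurable_integrand hf).aestronglyMeasurable (2 * K) ?_
  filter_upwards [ae_prod_nonneg hμ] with p hp
  exact abs_integrand_le hK hp.1 hp.2.1 hp.2.2

lemma abs_collision_le (hμ : ∀ᵐ x ∂μ, 0 ≤ x) {K : ℝ≥0} (hK : LipschitzOnWith K f (Ici 0)) :
    |collision μ f| ≤ 2 * K * μ.real univ ^ 3 := by
  have hbound : ∀ᵐ p : ℝ × ℝ × ℝ ∂(μ.prod (μ.prod μ)),
      ‖integrand f p.1 p.2.1 p.2.2‖ ≤ 2 * K := by
    filter_upwards [ae_prod_nonneg hμ] with p hp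
    exact abs_integrand_le hK hp.1 hp.2.1 hp.2.2
  refine (norm_integral_le_of_norm_le_const hbound).trans (le_of_eq ?_)
  rw [← univ_prod_univ, measureReal_prod_prod, ← univ_prod_univ, measureReal_prod_prod]
  ring

lemma integrable_symIntegrand (hμ : ∀ᵐ x ∂μ, 0 ≤ x) (hf : Measurable f) {K : ℝ≥0}
    (hK : LipschitzOnWith K f (Ici 0)) :
    Integrable (fun p : ℝ × ℝ × ℝ => symIntegrand f p.1 p.2.1 p.2.2) (μ.prod (μ.prod μ)) :=
  have h := integrable_integrand hμ hf hK
  (h.add (integrable_prod_rotate h)).add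
    (integrable_prod_rotate (F := fun x y z => integrand f y z x) (integrable_prod_rotate h))

lemma integral_symIntegrand (hμ : ∀ᵐ x ∂μ, 0 ≤ x) (hf : Measurable f) {K : ℝ≥0}
    (hK : LipschitzOnWith K f (Ici 0)) :
    ∫ p : ℝ × ℝ × ℝ, symIntegrand f p.1 p.2.1 p.2.2 ∂(μ.prod (μ.prod μ))
      = 3 * collision μ f := by
  have i1 := integrable_integrand hμ hf hK
  have i2 := integrable_prod_rotate i1
  have i3 := integrable_prod_rotate (F := fun x y z => integrand f y z x) i2
  have e2 := integral_prod_rotate μ (integrand f)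
  have e3 := integral_prod_rotate μ fun x y z => integrand f y z x
  simp only [symIntegrand]
  rw [integral_add (by exact i1.add i2) i3, integral_add i1 i2, e3, e2, ← collision_eq_integral]
  ring

lemma collision_nonneg (hμ : ∀ᵐ x ∂μ, 0 ≤ x) (hf : Measurable f) {K : ℝ≥0}
    (hK : LipschitzOnWith K f (Ici 0)) (hc : ConvexOn ℝ (Ici 0) f) : 0 ≤ collision μ f := by
  have h : 0 ≤ ∫ p : ℝ × ℝ × ℝ, symIntegrand f p.1 p.2.1 p.2.2 ∂(μ.prod (μ.prod μ)) := by
    refine integral_nonneg_of_ae ?_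
    filter_upwards [ae_prod_nonneg hμ] with p hp
    exact symIntegrand_nonneg hc hp.1 hp.2.1 hp.2.2
  rw [integral_symIntegrand hμ hf hK] at h
  linarith

/-- Triples made of a small frequency and of two frequencies of size comparable to `r` push mass
towards the origin. -/
lemma le_collision_cubic (hμ : ∀ᵐ x ∂μ, 0 ≤ x) {r : ℝ} (hr : 0 < r) :
    1 / (1536 * r) * (μ.real (Icc 0 (r / 16)) * μ.real (Ioc (r / 4) r) ^ 2)
      ≤ collision μ (cubic r) := by
  obtain ⟨K, hK⟩ := exists_lipschitzOnWith_cubic hr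
  have hf := (continuous_cubic r).measurable
  have hi := integrable_symIntegrand hμ hf hK
  have he := integral_symIntegrand hμ hf hK
  set s : Set (ℝ × ℝ × ℝ) := Icc 0 (r / 16) ×ˢ (Ioc (r / 4) r ×ˢ Ioc (r / 4) r) with hs
  have hsm : MeasurableSet s := by measurability
  have h1 : ∫ p in s, 1 / (512 * r) ∂(μ.prod (μ.prod μ))
      ≤ ∫ p in s, symIntegrand (cubic r) p.1 p.2.1 p.2.2 ∂(μ.prod (μ.prod μ)) :=
    setIntegral_mono_on (integrable_const _) hi.integrableOn hsm
      fun p hp => le_symIntegrand_cubic hr hp.1 hp.2.1 hp.2.2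
  have h2 : ∫ p in s, symIntegrand (cubic r) p.1 p.2.1 p.2.2 ∂(μ.prod (μ.prod μ))
      ≤ ∫ p : ℝ × ℝ × ℝ, symIntegrand (cubic r) p.1 p.2.1 p.2.2 ∂(μ.prod (μ.prod μ)) := by
    refine setIntegral_le_integral hi ?_
    filter_upwards [ae_prod_nonneg hμ] with p hp
    exact symIntegrand_nonneg (convexOn_cubic r (convex_Ici 0)) hp.1 hp.2.1 hp.2.2
  rw [he] at h2
  rw [setIntegral_const, hs, measureReal_prod_prod, measureReal_prod_prod, smul_eq_mul] at h1
  calc _ = μ.real (Icc 0 (r / 16)) * (μ.real (Ioc (r / 4) r) * μ.real (Ioc (r / 4) r))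
        * (1 / (512 * r)) / 3 := by field_simp; ring
    _ ≤ collision μ (cubic r) := by linarith

end Collision

/-! ### The truncated mass -/

/-- The mass of `μ` in `[0, r]`, smoothed by integrating `cubic r` instead of the indicator
function of `[0, r]`. -/
def truncMass (μ : Measure ℝ) (r : ℝ) : ℝ := ∫ ω, cubic r ω ∂μ

section TruncMass

variable {μ : Measure ℝ} {r : ℝ}

lemma truncMass_nonneg (μ : Measure ℝ) (r : ℝ) : 0 ≤ truncMass μ r :=
  integral_nonneg (cubic_nonneg r)

variable [IsFiniteMeasure μ]

lemma integrable_cubic (hμ : ∀ᵐ x ∂μ, 0 ≤ x) (hr : 0 ≤ r) : Integrable (cubic r) μ := by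
  refine Integrable.of_bound (continuous_cubic r).aestronglyMeasurable 1 ?_
  filter_upwards [hμ] with x hx
  rw [Real.norm_of_nonneg (cubic_nonneg r x)]
  exact cubic_le_one hr hx

lemma truncMass_mono (hμ : ∀ᵐ x ∂μ, 0 ≤ x) {s : ℝ} (hr : 0 < r) (hrs : r ≤ s) :
    truncMass μ r ≤ truncMass μ s := by
  refine integral_mono_ae (integrable_cubic hμ hr.le)
    (integrable_cubic hμ (hr.le.trans hrs)) ?_
  filter_upwards [hμ] with x hx
  exact cubic_mono_left hr hrs hx

lemma truncMass_le_measureReal (hμ : ∀ᵐ x ∂μ, 0 ≤ x) (hr : 0 < r) :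
    truncMass μ r ≤ μ.real (Icc 0 r) := by
  rw [← integral_indicator_one measurableSet_Icc]
  refine integral_mono_ae (integrable_cubic hμ hr.le)
    ((integrable_const 1).indicator measurableSet_Icc) ?_
  filter_upwards [hμ] with x hx
  by_cases hxr : x ≤ r
  · rw [indicator_of_mem (show x ∈ Icc 0 r from ⟨hx, hxr⟩)]
    exact cubic_le_one hr.le hx
  · rw [cubic_eq_zero_of_le hr (le_of_not_ge hxr)]
    exact indicator_nonneg (fun _ _ => zero_le_one) x

lemma measureReal_le_truncMass (hμ : ∀ᵐ x ∂μ, 0 ≤ x) (hr : 0 < r) :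
    μ.real (Icc 0 (r / 2)) ≤ 8 * truncMass μ r := by
  rw [← integral_indicator_one measurableSet_Icc, truncMass, ← integral_const_mul]
  refine integral_mono ((integrable_const 1).indicator measurableSet_Icc)
    ((integrable_cubic hμ hr.le).const_mul 8) fun x => indicator_le' (fun x hx => ?_)
      (fun x _ => mul_nonneg (by norm_num) (cubic_nonneg r x)) x
  simp only [Pi.one_apply]
  linarith [one_eighth_le_cubic hr hx.2]

lemma tendsto_truncMass (hμ : ∀ᵐ x ∂μ, 0 ≤ x) :
    Tendsto (truncMass μ) (𝓝[>] 0) (𝓝 (μ.real {0})) := by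
  rw [← integral_indicator_one (measurableSet_singleton 0)]
  refine tendsto_integral_filter_of_dominated_convergence (fun _ => 1)
    (Eventually.of_forall fun r => (continuous_cubic r).aestronglyMeasurable) ?_
    (integrable_const 1) ?_
  · filter_upwards [self_mem_nhdsWithin] with r (hr : 0 < r)
    filter_upwards [hμ] with x hx
    rw [Real.norm_of_nonneg (cubic_nonneg r x)]
    exact cubic_le_one hr.le hx
  · filter_upwards [hμ] with x hx
    rcases hx.eq_or_lt with rfl | hx
    · simp [cubic_zero_right]
    · rw [indicator_of_notMem (mem_singleton_iff.not.mpr hx.ne')]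
      refine tendsto_const_nhds.congr' ?_
      filter_upwards [Ioo_mem_nhdsGT hx] with r hr
      exact (cubic_eq_zero_of_le hr.1 hr.2.le).symm

end TruncMass

lemma measureReal_Icc_le_sum (μ : Measure ℝ) [IsFiniteMeasure μ] (a : ℝ) (u : ℕ → ℝ) (K : ℕ) :
    μ.real (Icc a (u 0)) ≤ ∑ k ∈ Finset.range K, μ.real (Ioc (u (k + 1)) (u k))
      + μ.real (Icc a (u K)) := by
  induction K with
  | zero => simp
  | succ K ih =>
    have h : μ.real (Icc a (u K)) ≤ μ.real (Ioc (u (K + 1)) (u K))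
        + μ.real (Icc a (u (K + 1))) := by
      refine (measureReal_mono fun x hx => ?_).trans (measureReal_union_le _ _)
      rcases le_or_gt x (u (K + 1)) with h | h
      · exact Or.inr ⟨hx.1, h⟩
      · exact Or.inl ⟨h, hx.2⟩
    rw [Finset.sum_range_succ]
    linarith

/-! ### Weak solutions -/

lemma measurable_of_measurable_integral {α : Type*} [MeasurableSpace α] {μ : α → Measure ℝ}
    [∀ a, IsFiniteMeasure (μ a)]
    (h : ∀ ψ : ℝ → ℝ, Continuous ψ → HasCompactSupport ψ → Measurable fun a => ∫ x, ψ x ∂(μ a))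
    (huniv : Measurable fun a => μ a univ) : Measurable μ := by
  refine Measurable.measure_of_isPiSystem
    (BorelSpace.measurable_eq.trans (borel_eq_generateFrom_Icc ℝ)) (isPiSystem_Icc id id) ?_ huniv
  rintro _ ⟨l, u, -, rfl⟩
  have hδ : ∀ n : ℕ, (0 : ℝ) < 1 / (n + 1) := fun n => by positivity
  let ψ : ℕ → ℝ → ℝ := fun n x => thickenedIndicator (hδ n) (Icc l u) x
  have hψc : ∀ n, HasCompactSupport (ψ n) := fun n => by
    have hbdd := (Metric.isBounded_Icc l u).thickening (δ := 1 / (n + 1))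
    refine HasCompactSupport.intro hbdd.isCompact_closure fun x hx => ?_
    simp only [ψ, thickenedIndicator_zero (hδ n) _ fun h => hx (subset_closure h), NNReal.coe_zero]
  have hreal : Measurable fun a => (μ a).real (Icc l u) :=
    measurable_of_tendsto_metrizable (fun n => h (ψ n) (by fun_prop) (hψc n))
      (tendsto_pi_nhds.mpr fun a => tendsto_integral_thickenedIndicator_of_isClosed (μ a)
        isClosed_Icc hδ tendsto_one_div_add_atTop_nhds_zero_nat)
  convert hreal.ennreal_ofReal using 2 with a
  exact (ofReal_measureReal (measure_ne_top _ _)).symm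

lemma stronglyMeasurable_collision_kernel {α : Type*} [MeasurableSpace α]
    (κ : ProbabilityTheory.Kernel α ℝ) [ProbabilityTheory.IsSFiniteKernel κ] {f : ℝ → ℝ}
    (hf : Measurable f) : StronglyMeasurable fun a => collision (κ a) f := by
  have h := StronglyMeasurable.integral_kernel
    (κ := ProbabilityTheory.Kernel.prod κ (ProbabilityTheory.Kernel.prod κ κ))
    (measurable_integrand hf).stronglyMeasurable
  simp only [ProbabilityTheory.Kernel.prod_apply] at h
  exact h

namespace IsWeakSolution

variable {ρ : ℝ} {f₀ : Measure ℝ} {g : ℝ → Measure ℝ}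

lemma isFiniteMeasure_sqrtMul (hg : IsWeakSolution ρ f₀ g) (hρ : ρ < -1) :
    IsFiniteMeasure (sqrtMul f₀) := by
  have := (hg.mem 1 zero_le_one).isFiniteMeasure hρ
  exact ⟨by rw [← hg.mass 1 one_pos]; exact measure_lt_top _ _⟩

lemma ae_nonneg (hg : IsWeakSolution ρ f₀ g) {t : ℝ} (ht : 0 < t) : ∀ᵐ x ∂(g t), 0 ≤ x :=
  (hg.mem t ht.le).ae_nonneg

lemma integral_sub_integral_initial (hg : IsWeakSolution ρ f₀ g) {φ : ℝ → ℝ}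
    (hφ : ContDiff ℝ 2 φ) (hc : HasCompactSupport φ) {T : ℝ} (hT : 0 < T) :
    (∫ ω, φ ω ∂(g T)) - ∫ ω, φ ω ∂(sqrtMul f₀) = ∫ t in (0 : ℝ)..T, collision (g t) φ := by
  obtain ⟨χ, hχ, hχc, hχ1⟩ := exists_contDiff_eventuallyEq_one_closedBall (0 : ℝ) T 2
  replace hχ1 : ∀ t ∈ uIcc 0 T, χ =ᶠ[𝓝 t] 1 := fun t ht => by
    rw [uIcc_of_le hT.le] at ht
    exact hχ1 t (by simpa [abs_of_nonneg ht.1] using ht.2)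
  have hval : ∀ t ∈ uIcc 0 T, χ t = 1 := fun t ht => (hχ1 t ht).eq_of_nhds
  have hsupp : HasCompactSupport (Function.uncurry fun t ω => χ t * φ ω) := by
    refine HasCompactSupport.intro (hχc.isCompact.prod hc.isCompact) ?_
    rintro ⟨t, ω⟩ hp
    rw [mem_prod, not_and_or] at hp
    rcases hp with hp | hp <;> simp [image_eq_zero_of_notMem_tsupport hp]
  have hderiv : ∫ t in (0 : ℝ)..T, ∫ ω, deriv (fun s => χ s * φ ω) t ∂(g t)
      = ∫ t in (0 : ℝ)..T, 0 := by
    refine intervalIntegral.integral_congr fun t ht => ?_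
    have (ω : ℝ) : (fun s => χ s * φ ω) =ᶠ[𝓝 t] fun _ => φ ω := by
      filter_upwards [hχ1 t ht] with s hs
      rw [hs, Pi.one_apply, one_mul]
    simp [(this _).deriv_eq]
  have hcollision : ∫ t in (0 : ℝ)..T, collision (g t) (fun ω => χ t * φ ω)
      = ∫ t in (0 : ℝ)..T, collision (g t) φ :=
    intervalIntegral.integral_congr fun t ht => by simp only [hval t ht, one_mul]
  have h := hg.weak (fun t ω => χ t * φ ω)
    ((hχ.comp contDiff_fst).mul (hφ.comp contDiff_snd)) hsupp T hT
  rw [hderiv, hcollision] at h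
  simpa [hval T right_mem_uIcc, hval 0 left_mem_uIcc] using h

variable [IsFiniteMeasure (sqrtMul f₀)]

lemma isFiniteMeasure (hg : IsWeakSolution ρ f₀ g) {t : ℝ} (ht : 0 < t) :
    IsFiniteMeasure (g t) :=
  ⟨by rw [hg.mass t ht]; exact measure_lt_top _ _⟩

lemma measurable_Ioi (hg : IsWeakSolution ρ f₀ g) : Measurable fun t : Ioi (0 : ℝ) => g t := by
  have (t : Ioi (0 : ℝ)) : IsFiniteMeasure (g t) := hg.isFiniteMeasure t.2
  refine measurable_of_measurable_integral (fun ψ hψ hψc => ?_) ?_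
  · exact ((hg.cont ψ hψ hψc).mono Ioi_subset_Ici_self).domRestrict.measurable
  · simp only [fun t : Ioi (0 : ℝ) => hg.mass t t.2, measurable_const]

lemma aestronglyMeasurable_collision (hg : IsWeakSolution ρ f₀ g) {f : ℝ → ℝ}
    (hf : Measurable f) :
    AEStronglyMeasurable (fun t => collision (g t) f) (volume.restrict (Ioi 0)) := by
  let κ : ProbabilityTheory.Kernel (Ioi (0 : ℝ)) ℝ := ⟨fun t => g t, hg.measurable_Ioi⟩
  have : ProbabilityTheory.IsFiniteKernel κ :=
    ⟨sqrtMul f₀ univ, measure_lt_top _ _, fun t => (hg.mass t t.2).le⟩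
  exact (aemeasurable_restrict_of_measurable_subtype measurableSet_Ioi
    (stronglyMeasurable_collision_kernel κ hf).measurable).aestronglyMeasurable

lemma intervalIntegrable_collision (hg : IsWeakSolution ρ f₀ g) {f : ℝ → ℝ} (hf : Measurable f)
    {K : ℝ≥0} (hK : LipschitzOnWith K f (Ici 0)) {s t : ℝ} (hs : 0 ≤ s) (ht : 0 ≤ t) :
    IntervalIntegrable (fun τ => collision (g τ) f) volume s t := by
  have hpos : uIoc s t ⊆ Ioi 0 := fun τ hτ => (le_min hs ht).trans_lt hτ.1
  rw [intervalIntegrable_iff]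
  refine IntegrableOn.of_bound (by simp [uIoc])
    ((hg.aestronglyMeasurable_collision hf).mono_set hpos) (2 * K * (sqrtMul f₀).real univ ^ 3)
    (ae_restrict_of_forall_mem measurableSet_uIoc fun τ hτ => ?_)
  have := hg.isFiniteMeasure (hpos hτ)
  rw [Measure.real, ← hg.mass τ (hpos hτ)]
  exact abs_collision_le (hg.ae_nonneg (hpos hτ)) hK

lemma truncMass_sub_initial (hg : IsWeakSolution ρ f₀ g) {r T : ℝ} (hr : 0 < r) (hT : 0 < T) :
    truncMass (g T) r - truncMass (sqrtMul f₀) r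
      = ∫ t in (0 : ℝ)..T, collision (g t) (cubic r) := by
  obtain ⟨φ, hφ, hc, he⟩ := exists_contDiff_eqOn_cubic hr
  have hcongr : ∀ {μ : Measure ℝ}, (∀ᵐ x ∂μ, 0 ≤ x) → ∫ ω, φ ω ∂μ = truncMass μ r := fun hμ =>
    integral_congr_ae (hμ.mono fun x hx => he hx)
  rw [← hcongr (hg.ae_nonneg hT), ← hcongr (ae_nonneg_sqrtMul f₀),
    hg.integral_sub_integral_initial hφ hc hT]
  refine intervalIntegral.integral_congr_Ioo_of_le hT.le fun t ht => ?_
  have := hg.isFiniteMeasure ht.1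
  exact collision_congr (hg.ae_nonneg ht.1) he

lemma truncMass_sub (hg : IsWeakSolution ρ f₀ g) {r s t : ℝ} (hr : 0 < r) (hs : 0 < s)
    (ht : 0 < t) :
    truncMass (g t) r - truncMass (g s) r = ∫ τ in s..t, collision (g τ) (cubic r) := by
  obtain ⟨K, hK⟩ := exists_lipschitzOnWith_cubic hr
  have hi : ∀ {b : ℝ}, 0 ≤ b →
      IntervalIntegrable (fun τ => collision (g τ) (cubic r)) volume 0 b := fun hb =>
    hg.intervalIntegrable_collision (continuous_cubic r).measurable hK le_rfl hb
  rw [← intervalIntegral.integral_interval_sub_left (hi ht.le) (hi hs.le),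
    ← hg.truncMass_sub_initial hr ht, ← hg.truncMass_sub_initial hr hs]
  ring

lemma collision_cubic_nonneg (hg : IsWeakSolution ρ f₀ g) {r t : ℝ} (hr : 0 < r) (ht : 0 < t) :
    0 ≤ collision (g t) (cubic r) := by
  have := hg.isFiniteMeasure ht
  obtain ⟨K, hK⟩ := exists_lipschitzOnWith_cubic hr
  exact collision_nonneg (hg.ae_nonneg ht) (continuous_cubic r).measurable hK
    (convexOn_cubic r (convex_Ici 0))

lemma truncMass_initial_le (hg : IsWeakSolution ρ f₀ g) {r t : ℝ} (hr : 0 < r) (ht : 0 < t) :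
    truncMass (sqrtMul f₀) r ≤ truncMass (g t) r := by
  rw [← sub_nonneg, hg.truncMass_sub_initial hr ht, intervalIntegral.integral_of_le ht.le]
  exact setIntegral_nonneg measurableSet_Ioc fun τ hτ => hg.collision_cubic_nonneg hr hτ.1

lemma truncMass_mono_time (hg : IsWeakSolution ρ f₀ g) {r s t : ℝ} (hr : 0 < r) (hs : 0 < s)
    (hst : s ≤ t) : truncMass (g s) r ≤ truncMass (g t) r := by
  rw [← sub_nonneg, hg.truncMass_sub hr hs (hs.trans_le hst)]
  exact intervalIntegral.integral_nonneg hst fun τ hτ =>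
    hg.collision_cubic_nonneg hr (hs.trans_le hτ.1)

end IsWeakSolution

/-! ### Doubling of the truncated mass -/

/-- The mass of `μ` near the origin is at least that of the density `N / √ω`, up to the frequency
`B` and a numerical factor: this is the mass of `sqrtMul` of a Rayleigh-Jeans measure. -/
def HasSqrtMass (N B : ℝ) (μ : Measure ℝ) : Prop := ∀ r ∈ Ioc 0 B, N * √r ≤ truncMass μ r

lemma sqrt_div_four_pow (r : ℝ) (k : ℕ) : √(r / 4 ^ k) = √r / 2 ^ k := by
  rw [show (4 : ℝ) ^ k = (2 ^ k) ^ 2 by rw [← pow_mul, mul_comm, pow_mul]; norm_num,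
    Real.sqrt_div' _ (by positivity), Real.sqrt_sq (by positivity)]

lemma sum_range_pow_le {q : ℝ} (h0 : 0 ≤ q) (h1 : q < 1) (K : ℕ) :
    ∑ k ∈ Finset.range K, q ^ k ≤ (1 - q)⁻¹ :=
  sum_le_hasSum _ (fun _ _ => by positivity) (hasSum_geometric_of_lt_one h0 h1)

-- Cauchy-Schwarz after splitting `(1 / 2) ^ k` into `(3 / 4) ^ k`, whose sum is the factor `4`, and
-- `(2 / 3) ^ k`.
lemma sq_sum_le_of_sq_le_div_two_pow {m c : ℕ → ℝ} (h : ∀ k, m k ^ 2 ≤ c k / 2 ^ k) (K : ℕ) :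
    (∑ k ∈ Finset.range K, m k) ^ 2 ≤ 4 * ∑ k ∈ Finset.range K, (2 / 3) ^ k * c k := by
  have hc : ∀ k, 0 ≤ c k := fun k => by
    have := (sq_nonneg (m k)).trans (h k)
    rwa [le_div_iff₀ (by positivity), zero_mul] at this
  have hterm : ∀ k, 0 ≤ (2 / 3) ^ k * c k := fun k => mul_nonneg (by positivity) (hc k)
  have hsplit : ∀ k, m k ^ 2 ≤ (3 / 4) ^ k * ((2 / 3) ^ k * c k) := fun k => by
    rw [← mul_assoc, ← mul_pow, show (3 / 4 * (2 / 3) : ℝ) = 1 / 2 by norm_num, one_div_pow,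
      one_div_mul_eq_div]
    exact h k
  calc _ ≤ (∑ k ∈ Finset.range K, (3 / 4 : ℝ) ^ k) * ∑ k ∈ Finset.range K, (2 / 3) ^ k * c k :=
        Finset.sum_sq_le_sum_mul_sum_of_sq_le_mul _ (fun k _ => by positivity)
          (fun k _ => hterm k) fun k _ => hsplit k
    _ ≤ _ := by
        gcongr
        · exact Finset.sum_nonneg fun k _ => hterm k
        · exact (sum_range_pow_le (by norm_num) (by norm_num) K).trans (by norm_num)

lemma div_four_pow_mem_Ioc {r B : ℝ} (hr : r ∈ Ioc 0 B) (k : ℕ) : r / 4 ^ k ∈ Ioc 0 B :=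
  ⟨div_pos hr.1 (by positivity),
    (div_le_self hr.1.le (one_le_pow₀ (by norm_num))).trans hr.2⟩

section Measure

variable {μ : Measure ℝ} [IsFiniteMeasure μ] {B N r : ℝ}

lemma exists_truncMass_le (hμ : ∀ᵐ x ∂μ, 0 ≤ x) (h0 : μ {0} = 0) (hr : 0 < r) {ε : ℝ}
    (hε : 0 < ε) : ∃ K : ℕ, truncMass μ (2 * (r / 4 ^ K)) ≤ ε := by
  have hlim : Tendsto (fun K : ℕ => 2 * (r / (4 : ℝ) ^ K)) atTop (𝓝[>] 0) := by
    refine tendsto_nhdsWithin_iff.mpr ⟨?_, Eventually.of_forall fun K => ?_⟩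
    · simpa using (tendsto_const_nhds.div_atTop
        (tendsto_pow_atTop_atTop_of_one_lt (by norm_num : (1 : ℝ) < 4))).const_mul (2 : ℝ)
    · exact mem_Ioi.mpr (by positivity)
  have h := (tendsto_truncMass hμ).comp hlim
  rw [Measure.real, h0, ENNReal.toReal_zero] at h
  exact (h.eventually_le_const hε).exists

lemma HasSqrtMass.mul_sq_measureReal_le_collision (h : HasSqrtMass N B μ)
    (hμ : ∀ᵐ x ∂μ, 0 ≤ x) (hr : r ∈ Ioc 0 B) :
    N * μ.real (Ioc (r / 4) r) ^ 2 ≤ 6144 * √r * collision μ (cubic r) := by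
  have hr0 : 0 < r := hr.1
  have : 0 < √r := Real.sqrt_pos.mpr hr0
  have hsmall : N * (√r / 4) ≤ μ.real (Icc 0 (r / 16)) := by
    have hm : r / 16 ∈ Ioc 0 B := ⟨by linarith, by linarith [hr.2]⟩
    rw [show √r / 4 = √(r / 16) by rw [Real.sqrt_div' _ (by norm_num)]; norm_num]
    exact (h _ hm).trans (truncMass_le_measureReal hμ hm.1)
  have hrate : 1 / (1536 * r) * (N * (√r / 4) * μ.real (Ioc (r / 4) r) ^ 2)
      ≤ collision μ (cubic r) := le_trans (by gcongr) (le_collision_cubic hμ hr0)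
  calc N * μ.real (Ioc (r / 4) r) ^ 2
      = 6144 * √r * (1 / (1536 * r) * (N * (√r / 4) * μ.real (Ioc (r / 4) r) ^ 2)) := by
        field_simp
        rw [Real.sq_sqrt hr0.le]
        ring
    _ ≤ _ := by gcongr

lemma half_mul_sqrt_le_sum_measureReal (hμ : ∀ᵐ x ∂μ, 0 ≤ x) (h : HasSqrtMass N B μ)
    (hr : r ∈ Ioc 0 B) {K : ℕ} (hK : truncMass μ (2 * (r / 4 ^ K)) ≤ N * √r / 16) :
    N * √r / 2 ≤ ∑ k ∈ Finset.range K, μ.real (Ioc (r / 4 ^ k / 4) (r / 4 ^ k)) := by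
  have hsum := measureReal_Icc_le_sum μ 0 (fun k => r / 4 ^ k) K
  simp only [pow_zero, div_one, pow_succ, ← div_div] at hsum
  have htail := measureReal_le_truncMass hμ (r := 2 * (r / 4 ^ K))
    (mul_pos two_pos (div_four_pow_mem_Ioc hr K).1)
  rw [mul_div_cancel_left₀ _ two_ne_zero] at htail
  linarith [h r hr, truncMass_le_measureReal hμ hr.1]

lemma HasSqrtMass.pow_three_mul_sqrt_le_sum_collision (h : HasSqrtMass N B μ)
    (hμ : ∀ᵐ x ∂μ, 0 ≤ x) (hN : 0 < N) (hr : r ∈ Ioc 0 B) {K : ℕ}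
    (hK : truncMass μ (2 * (r / 4 ^ K)) ≤ N * √r / 16) :
    N ^ 3 * √r ≤ 98304 * ∑ k ∈ Finset.range K, (2 / 3) ^ k * collision μ (cubic (r / 4 ^ k)) := by
  set m : ℕ → ℝ := fun k => μ.real (Ioc (r / 4 ^ k / 4) (r / 4 ^ k))
  set c : ℕ → ℝ := fun k => collision μ (cubic (r / 4 ^ k))
  have hs : 0 < √r := Real.sqrt_pos.mpr hr.1
  have hscale : ∀ k, m k ^ 2 ≤ 6144 * √r / N * c k / 2 ^ k := fun k => by
    have hk := h.mul_sq_measureReal_le_collision hμ (div_four_pow_mem_Ioc hr k)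
    rw [sqrt_div_four_pow] at hk
    calc m k ^ 2 = N * m k ^ 2 / N := by field_simp
      _ ≤ 6144 * (√r / 2 ^ k) * c k / N := div_le_div_of_nonneg_right hk hN.le
      _ = _ := by ring
  have hcs := sq_sum_le_of_sq_le_div_two_pow hscale K
  have hmass := half_mul_sqrt_le_sum_measureReal hμ h hr hK
  have hsqmass : (N * √r / 2) ^ 2 ≤ (∑ k ∈ Finset.range K, m k) ^ 2 := by gcongr
  calc N ^ 3 * √r = 4 * N / √r * (N * √r / 2) ^ 2 := by field_simp; ring
    _ ≤ 4 * N / √r * (4 * ∑ k ∈ Finset.range K, (2 / 3) ^ k * (6144 * √r / N * c k)) := by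
        gcongr
        exact hsqmass.trans hcs
    _ = 4 * N / √r * (4 * (6144 * √r / N * ∑ k ∈ Finset.range K, (2 / 3) ^ k * c k)) := by
        simp only [Finset.mul_sum, mul_left_comm]
    _ = 98304 * ∑ k ∈ Finset.range K, (2 / 3) ^ k * c k := by field_simp; ring

lemma sum_pow_mul_truncMass_sub_le (hμ : ∀ᵐ x ∂μ, 0 ≤ x) (ν : Measure ℝ) (hr : 0 < r) {q : ℝ}
    (hq0 : 0 ≤ q) (hq1 : q < 1) (K : ℕ) :
    ∑ k ∈ Finset.range K, q ^ k * (truncMass μ (r / 4 ^ k) - truncMass ν (r / 4 ^ k))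
      ≤ (1 - q)⁻¹ * truncMass μ r := by
  calc _ ≤ ∑ k ∈ Finset.range K, q ^ k * truncMass μ r := by
        gcongr with k
        have hk := div_four_pow_mem_Ioc (B := r) ⟨hr, le_rfl⟩ k
        linarith [truncMass_mono hμ hk.1 hk.2, truncMass_nonneg ν (r / 4 ^ k)]
    _ ≤ _ := by
        rw [← Finset.sum_mul]
        gcongr
        · exact truncMass_nonneg _ _
        · exact sum_range_pow_le hq0 hq1 K

end Measure

namespace IsWeakSolution

variable {ρ : ℝ} {f₀ : Measure ℝ} {g : ℝ → Measure ℝ} [IsFiniteMeasure (sqrtMul f₀)]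
  {B N r s t T : ℝ}

lemma sub_mul_le_sum_truncMass_sub (hg : IsWeakSolution ρ f₀ g) {ι : Type*} (S : Finset ι)
    (w R : ι → ℝ) (hR : ∀ i, 0 < R i) (hs : 0 < s) (hst : s ≤ t) {c : ℝ}
    (hc : ∀ τ ∈ Icc s t, c ≤ ∑ i ∈ S, w i * collision (g τ) (cubic (R i))) :
    (t - s) * c ≤ ∑ i ∈ S, w i * (truncMass (g t) (R i) - truncMass (g s) (R i)) := by
  have hint : ∀ i ∈ S, IntervalIntegrable (fun τ => w i * collision (g τ) (cubic (R i)))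
      volume s t := fun i _ => by
    obtain ⟨K, hK⟩ := exists_lipschitzOnWith_cubic (hR i)
    exact (hg.intervalIntegrable_collision (continuous_cubic _).measurable hK hs.le
      (hs.le.trans hst)).const_mul _
  have hsum : IntervalIntegrable (fun τ => ∑ i ∈ S, w i * collision (g τ) (cubic (R i)))
      volume s t := by
    simpa only [Finset.sum_fn] using IntervalIntegrable.sum S hint
  calc (t - s) * c = ∫ _ in s..t, c := by rw [intervalIntegral.integral_const, smul_eq_mul]
    _ ≤ ∫ τ in s..t, ∑ i ∈ S, w i * collision (g τ) (cubic (R i)) :=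
        intervalIntegral.integral_mono_on hst intervalIntegrable_const hsum hc
    _ = _ := by
        rw [intervalIntegral.integral_finsetSum hint]
        refine Finset.sum_congr rfl fun i _ => ?_
        rw [intervalIntegral.integral_const_mul, hg.truncMass_sub (hR i) hs (hs.trans_le hst)]

lemma hasSqrtMass_mono_time (hg : IsWeakSolution ρ f₀ g) (hs : 0 < s) (hst : s ≤ t)
    (h : HasSqrtMass N B (g s)) : HasSqrtMass N B (g t) := fun r hr =>
  (h r hr).trans (hg.truncMass_mono_time hr.1 hs hst)

lemma sub_mul_pow_three_mul_sqrt_le_truncMass (hg : IsWeakSolution ρ f₀ g) (hN : 0 < N)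
    (hs : 0 < s) (hst : s ≤ t) (htT : t ≤ T) (h0 : g T {0} = 0) (h : HasSqrtMass N B (g s))
    (hr : r ∈ Ioc 0 B) : (t - s) * (N ^ 3 * √r) ≤ 294912 * truncMass (g t) r := by
  have ht := hs.trans_le hst
  have hT := ht.trans_le htT
  have := hg.isFiniteMeasure ht
  have := hg.isFiniteMeasure hT
  obtain ⟨K, hK⟩ := exists_truncMass_le (hg.ae_nonneg hT) h0 hr.1
    (show 0 < N * √r / 16 by have := Real.sqrt_pos.mpr hr.1; positivity)
  have hR : ∀ k : ℕ, 0 < r / 4 ^ k := fun k => (div_four_pow_mem_Ioc hr k).1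
  have hrate : ∀ τ ∈ Icc s t, N ^ 3 * √r / 98304
      ≤ ∑ k ∈ Finset.range K, (2 / 3) ^ k * collision (g τ) (cubic (r / 4 ^ k)) := fun τ hτ => by
    have hτ0 := hs.trans_le hτ.1
    have := hg.isFiniteMeasure hτ0
    rw [div_le_iff₀' (by norm_num)]
    exact (hg.hasSqrtMass_mono_time hs hτ.1 h).pow_three_mul_sqrt_le_sum_collision
      (hg.ae_nonneg hτ0) hN hr
      ((hg.truncMass_mono_time (mul_pos two_pos (hR K)) hτ0 (hτ.2.trans htT)).trans hK)
  have hlow := hg.sub_mul_le_sum_truncMass_sub _ _ _ hR hs hst hrate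
  have hup := sum_pow_mul_truncMass_sub_le (hg.ae_nonneg ht) (g s) hr.1
    (by norm_num : (0 : ℝ) ≤ 2 / 3) (by norm_num) K
  norm_num at hup
  linarith

lemma hasSqrtMass_two_mul (hg : IsWeakSolution ρ f₀ g) (hN : 0 < N) (hs : 0 < s)
    (hT : s + 600000 / N ^ 2 ≤ T) (h0 : g T {0} = 0) (h : HasSqrtMass N B (g s)) :
    HasSqrtMass (2 * N) B (g (s + 600000 / N ^ 2)) := fun r hr => by
  have hgrow := hg.sub_mul_pow_three_mul_sqrt_le_truncMass hN hs
    (le_add_of_nonneg_right (by positivity)) hT h0 h hr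
  have e : (s + 600000 / N ^ 2 - s) * (N ^ 3 * √r) = 600000 * (N * √r) := by
    field_simp
    ring
  rw [e] at hgrow
  have : 0 ≤ N * √r := by positivity
  linarith

lemma hasSqrtMass_two_pow_mul (hg : IsWeakSolution ρ f₀ g) (h0 : g T {0} = 0) (j : ℕ)
    (hN : 0 < N) (hs : 0 < s) (hT : s + 800000 / N ^ 2 ≤ T) (h : HasSqrtMass N B (g s)) :
    HasSqrtMass (2 ^ j * N) B (g T) := by
  induction j generalizing N s with
  | zero =>
    rw [pow_zero, one_mul]
    exact hg.hasSqrtMass_mono_time hs (le_trans (le_add_of_nonneg_right (by positivity)) hT) h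
  | succ j ih =>
    have htime : 600000 / N ^ 2 + 800000 / (2 * N) ^ 2 = 800000 / N ^ 2 := by
      field_simp
      norm_num
    have hrest : 0 ≤ 800000 / (2 * N) ^ 2 := by positivity
    rw [pow_succ, mul_assoc]
    exact ih (by positivity) (by positivity) (by linarith)
      (hg.hasSqrtMass_two_mul hN hs (by linarith) h0 h)

lemma measure_singleton_zero_pos (hg : IsWeakSolution ρ f₀ g) (hB : 0 < B) (hN : 0 < N)
    (hs : 0 < s) (hT : s + 800000 / N ^ 2 ≤ T) (h : HasSqrtMass N B (g s)) : 0 < g T {0} := by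
  by_contra hcon
  have h0 : g T {0} = 0 := nonpos_iff_eq_zero.mp (not_lt.mp hcon)
  have hNB : 0 < N * √B := mul_pos hN (Real.sqrt_pos.mpr hB)
  obtain ⟨j, hj⟩ := pow_unbounded_of_one_lt (truncMass (g T) B / (N * √B))
    (one_lt_two : (1 : ℝ) < 2)
  have hgrow := hg.hasSqrtMass_two_pow_mul h0 j hN hs hT h B ⟨hB, le_rfl⟩
  rw [div_lt_iff₀ hNB] at hj
  linarith

lemma hasSqrtMass_of_initial (hg : IsWeakSolution ρ f₀ g) {A : ℝ} (hA : 0 ≤ A)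
    (h : ∀ r ∈ Ioc 0 B, A * √r ≤ (sqrtMul f₀).real (Icc 0 r)) (ht : 0 < t) :
    HasSqrtMass (A / 16) B (g t) := fun r hr => by
  have hsqrt : √r / 2 ≤ √(r / 2) := by
    have hr0 := hr.1.le
    rw [Real.le_sqrt (by positivity) (by positivity), div_pow, Real.sq_sqrt hr0]
    linarith
  have hmass := (h (r / 2) ⟨half_pos hr.1, (half_le_self hr.1.le).trans hr.2⟩).trans
    (measureReal_le_truncMass (ae_nonneg_sqrtMul f₀) hr.1)
  have hAr : A * (√r / 2) ≤ A * √(r / 2) := by gcongr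
  linarith [hg.truncMass_initial_le hr.1 ht]

end IsWeakSolution

/-! ### The initial data -/

lemma sqrtMul_mono {μ ν : Measure ℝ} (h : μ ≤ ν) : sqrtMul μ ≤ sqrtMul ν :=
  Measure.le_iff.mpr fun s hs => by
    rw [sqrtMul, sqrtMul, withDensity_apply _ hs, withDensity_apply _ hs]
    exact lintegral_mono' (Measure.restrict_mono subset_rfl h) le_rfl

lemma le_sqrtMul_rayleighJeans {A r : ℝ} (hA : 0 ≤ A) (hr : 0 < r) :
    ENNReal.ofReal (A * √r) ≤ sqrtMul ((rayleighJeans A).restrict (Ioo 0 r)) (Icc 0 r) := by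
  have hm : Measurable fun ω : ℝ => ENNReal.ofReal √ω := by fun_prop
  have hm' : Measurable fun ω : ℝ => ENNReal.ofReal (A * ω⁻¹) := by fun_prop
  rw [rayleighJeans, restrict_withDensity measurableSet_Ioo,
    Measure.restrict_restrict measurableSet_Ioo, inter_eq_left.mpr Ioo_subset_Ioi_self, sqrtMul,
    ← withDensity_mul _ hm' hm, withDensity_apply _ measurableSet_Icc,
    Measure.restrict_restrict measurableSet_Icc, inter_eq_right.mpr Ioo_subset_Icc_self]
  calc ENNReal.ofReal (A * √r) = ∫⁻ _ in Ioo 0 r, ENNReal.ofReal (A / √r) := by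
        rw [setLIntegral_const, Real.volume_Ioo, sub_zero, ← ENNReal.ofReal_mul (by positivity),
          div_mul_eq_mul_div, mul_div_assoc, Real.div_sqrt]
    _ ≤ ∫⁻ ω in Ioo 0 r, ENNReal.ofReal (A * ω⁻¹) * ENNReal.ofReal √ω := by
        refine setLIntegral_mono (hm'.mul hm) fun ω hω => ?_
        have hω0 : 0 < ω := hω.1
        rw [← ENNReal.ofReal_mul (by positivity)]
        refine ENNReal.ofReal_le_ofReal ?_
        rw [mul_assoc, inv_mul_eq_div, Real.sqrt_div_self, ← div_eq_mul_inv]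
        have := Real.sqrt_pos.mpr hω0
        have := Real.sqrt_le_sqrt hω.2.le
        gcongr

lemma rayleighJeans_restrict_le_initialData {B r : ℝ} (hrB : r ≤ B) (A : ℝ) (g₀ : Measure ℝ) :
    (rayleighJeans A).restrict (Ioo 0 r) ≤ initialData A B g₀ :=
  (Measure.restrict_mono_set _ (Ioo_subset_Ioo_right hrB)).trans (Measure.le_add_right le_rfl)

lemma le_measureReal_sqrtMul_initialData {A B r : ℝ} (hA : 0 ≤ A) (hr : r ∈ Ioc 0 B)
    (g₀ : Measure ℝ) [IsFiniteMeasure (sqrtMul (initialData A B g₀))] :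
    A * √r ≤ (sqrtMul (initialData A B g₀)).real (Icc 0 r) :=
  (ENNReal.ofReal_le_iff_le_toReal (measure_ne_top _ _)).mp <|
    (le_sqrtMul_rayleighJeans hA hr.1).trans
      (sqrtMul_mono (rayleighJeans_restrict_le_initialData hr.2 A g₀) _)

end WaveKinetic

end

theorem theorem1_general :
    ∃ C : ℝ, 0 < C ∧ ∀ A B ρ : ℝ, 0 < A → 0 < B → ∀ f₀ : Measure ℝ,
      IsFiniteMeasure (WaveKinetic.sqrtMul f₀) →
      (∀ r ∈ Ioc 0 B, A * √r ≤ (WaveKinetic.sqrtMul f₀).real (Icc 0 r)) →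
      ∀ g : ℝ → Measure ℝ, WaveKinetic.IsWeakSolution ρ f₀ g →
        ∀ t : ℝ, C * A ^ (-2 : ℤ) < t → 0 < g t {0} := by
  refine ⟨800000 * 16 ^ 2, by norm_num, fun A B ρ hA hB f₀ _ hf₀ g hg t ht => ?_⟩
  have htime : 800000 / (A / 16) ^ 2 < t := by
    convert ht using 1
    rw [zpow_neg, zpow_ofNat]
    field_simp
  have hs : 0 < t - 800000 / (A / 16) ^ 2 := sub_pos.mpr htime
  exact hg.measure_singleton_zero_pos hB (by positivity : 0 < A / 16) hs (sub_add_cancel _ _).le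
    (hg.hasSqrtMass_of_initial hA.le hf₀ hs)

theorem theorem1 :
    ∃ C : ℝ, 0 < C ∧ ∀ A B ρ : ℝ, 0 < A → 0 < B → ρ < -1 →
      ∀ g₀ : MeasureTheory.Measure ℝ, WaveKinetic.MemMRho ρ g₀ →
        ∀ g : ℝ → MeasureTheory.Measure ℝ,
          WaveKinetic.IsWeakSolution ρ (WaveKinetic.initialData A B g₀) g →
            ∀ t : ℝ, C * A ^ (-2 : ℤ) < t → 0 < g t {0} :=
  theorem1_general.imp fun _ ⟨hC, h⟩ => ⟨hC, fun A B ρ hA hB hρ g₀ _ g hg =>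
    have := hg.isFiniteMeasure_sqrtMul hρ
    h A B ρ hA hB _ this (fun _ hr => WaveKinetic.le_measureReal_sqrtMul_initialData hA.le hr g₀)
      g hg⟩
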